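/- Work over a (partially) ordered commutative ring $R$ (for instance $\mathbb{Z}$, $\mathbb{Q}$ or $\mathbb{R}$) and in the variables $x_1,x_2,\ldots$. For a composition $\beta=(\beta_1,\ldots,\beta_k)$ let $M_\beta=\sum_{i_1<\cdots<i_k}x_{i_1}^{\beta_1}\cdots x_{i_k}^{\beta_k}$, and let $F_\alpha=\sum_\beta M_\beta$, over all refinements $\beta$ of $\alpha$, be the fundamental quasisymmetric functions. For a partition $\lambda$ let $s_\lambda=\sum_{T\in SSYT(\lambda)}x^T$ be the Schur function, and let $SYT(\lambda)$ be the set of standard tableaux of shape $\lambda$. A descent of $T\in SYT(\lambda)$ is an entry $i$ such that $i+1$ lies in a row of greater index (rows numbered from the top); if $i_1<\cdots<i_k$ are the descents of $T$ and $n=|\lambda|\ge 1$, then $\mathrm{DesComp}(T)=(i_1,i_2-i_1,\ldots,n-i_k)$, and for $n=0$ it is the empty composition. A function is called $F$-positive (Schur-positive) if it is a finite linear combination of the $F_\beta$ (of the $s_\lambda$) with coefficients $\ge 0$. Let $f=\sum_\beta c_\beta F_\beta$ (a finite sum, not necessarily homogeneous, with coefficients in $R$) be a symmetric function. (1) Let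 $\alpha$ be the lexicographically largest composition with $c_\alpha\neq 0$ (if $f\ne 0$). Then $\alpha$ is a partition. If moreover $f$ is Schur-positive, then $f-c_\alpha s_\alpha$ is Schur-positive and $F$-positive. (2) For every such symmetric $f$ (Schur-positive or not), the following algorithm terminates and gives the expansion of $f$ in Schur functions. Start with $S=\sum_\beta c_\beta F_\beta$ and $g=0$. As long as $S\neq 0$, let $\alpha$ be the lexicographically largest composition whose coefficient $S_\alpha$ in $S$ is nonzero; $\alpha$ is always a partition; replace $S$ by $S-S_\alpha\sum_{T\in SYT(\alpha)}F_{\mathrm{DesComp}(T)}$ and $g$ by $g+S_\alpha s_\alpha$. When $S=0$, one has $f=g$. -/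

import Mathlib

namespace QSym

noncomputable section

/-- Compositions of all sizes (finite sequences of positive integers, the empty one included). -/
abbrev Comp : Type := Σ n : ℕ, Composition n

/-- The list of parts of a composition. -/
abbrev Comp.parts (α : Comp) : List ℕ := α.2.blocks

/-- A composition is a partition if its parts are weakly decreasing. -/
def Comp.IsPartition (α : Comp) : Prop := α.parts.SortedGE

/-- The Young diagram whose `i`-th row has length the `i`-th part of a partition. -/
def Comp.diagram (α : Comp) (hα : α.IsPartition) : YoungDiagram :=
  YoungDiagram.ofRowLens α.parts hα

/-- `Refines β α`: adjacent parts of `β` can be summed to obtain `α`. (Since the parts of `α` are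
positive, the groups of adjacent parts are automatically nonempty.) -/
def Refines {n : ℕ} (β α : Composition n) : Prop :=
  ∃ L : List (List ℕ), L.flatten = β.blocks ∧ L.map List.sum = α.blocks

/-- The nonzero exponents of the monomial `x ^ m`, listed in the order of the variables. -/
def exponents (m : ℕ →₀ ℕ) : List ℕ := (m.support.sort (· ≤ ·)).map m

open Classical in
/-- The monomial quasisymmetric function
`M_β = ∑_{i₁ < ⋯ < i_k} x_{i₁} ^ β₁ ⋯ x_{i_k} ^ β_k` in the variables `x₀, x₁, x₂, …`: the sum of
all monomials whose nonzero exponents, in the order of the variables, are `β₁, …, β_k`. -/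
def monomialQSym (R : Type*) [CommRing R] {n : ℕ} (β : Composition n) : MvPowerSeries ℕ R :=
  fun m => if exponents m = β.blocks then 1 else 0

open Classical in
/-- The fundamental quasisymmetric function `F_α`, the sum of the `M_β` over all refinements `β`
of `α`. -/
def fundamental (R : Type*) [CommRing R] (α : Comp) : MvPowerSeries ℕ R :=
  ∑ β : Composition α.1 with Refines β α.2, monomialQSym R β

/-- The weight of a tableau: the exponent `m i` is the number of entries equal to `i`. -/
def weight {μ : YoungDiagram} (T : SemistandardYoungTableau μ) : ℕ →₀ ℕ :=
  ∑ c ∈ μ.cells, Finsupp.single (T c.1 c.2) 1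

/-- The Schur function `s_μ = ∑_T x ^ T`, over all semistandard tableaux `T` of shape `μ`: the
coefficient of `x ^ m` is the number of such `T` of weight `m`. (Entries and variables are numbered
from `0`.) -/
def schur (R : Type*) [CommRing R] (μ : YoungDiagram) : MvPowerSeries ℕ R :=
  fun m => (Nat.card {T : SemistandardYoungTableau μ // weight T = m} : R)

/-- Invariance under all permutations of the variables. -/
def IsSymmetric {R : Type*} [CommRing R] (f : MvPowerSeries ℕ R) : Prop :=
  ∀ (σ : Equiv.Perm ℕ) (m : ℕ →₀ ℕ),
    MvPowerSeries.coeff (m.mapDomain σ) f = MvPowerSeries.coeff m f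

/-- The finite linear combination `∑ c_β F_β`. -/
def sumF {R : Type*} [CommRing R] (c : Comp →₀ R) : MvPowerSeries ℕ R :=
  c.sum fun β r => r • fundamental R β

/-- The finite linear combination `∑ a_μ s_μ`. -/
def sumSchur {R : Type*} [CommRing R] (a : YoungDiagram →₀ R) : MvPowerSeries ℕ R :=
  a.sum fun μ r => r • schur R μ

/-- `f` is a linear combination of fundamental quasisymmetric functions with coefficients `≥ 0`. -/
def FPositive {R : Type*} [CommRing R] [PartialOrder R] (f : MvPowerSeries ℕ R) : Prop :=
  ∃ d : Comp →₀ R, (∀ β, 0 ≤ d β) ∧ f = sumF d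

/-- `f` is a linear combination of Schur functions with coefficients `≥ 0`. -/
def SchurPositive {R : Type*} [CommRing R] [PartialOrder R] (f : MvPowerSeries ℕ R) : Prop :=
  ∃ a : YoungDiagram →₀ R, (∀ μ, 0 ≤ a μ) ∧ f = sumSchur a

/-- `α` is the lexicographically largest composition whose coefficient in `c` is nonzero. -/
def IsLeading {R : Type*} [CommRing R] (c : Comp →₀ R) (α : Comp) : Prop :=
  c α ≠ 0 ∧ ∀ β : Comp, c β ≠ 0 → β.parts ≤ α.parts

/-- Standard tableaux with `n` cells. Entries are numbered from `0`, so each of `0, …, n - 1`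
appears exactly once. -/
def SYT (μ : YoungDiagram) : Type :=
  {T : SemistandardYoungTableau μ //
    Set.BijOn (fun c : ℕ × ℕ => T c.1 c.2) (μ.cells : Set (ℕ × ℕ)) (Set.Iio μ.card)}

instance (μ : YoungDiagram) : Finite (SYT μ) := by
  let φ : SYT μ → (μ.cells → Fin μ.card) := fun T c => ⟨T.1 c.1.1 c.1.2, T.2.mapsTo c.2⟩
  refine Finite.of_injective φ fun T T' h => Subtype.ext ?_
  ext i j
  by_cases hc : (i, j) ∈ μ
  · exact congrArg Fin.val (congrFun h ⟨(i, j), hc⟩)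
  · rw [T.1.zeros hc, T'.1.zeros hc]

instance (μ : YoungDiagram) : Fintype (SYT μ) := Fintype.ofFinite _

open Classical in
/-- The descents of a standard tableau: the entries `i` such that `i + 1` lies in a row of greater
index. -/
def descents {μ : YoungDiagram} (T : SYT μ) : Finset (Fin (μ.card - 1)) :=
  {i | ∃ a ∈ μ.cells, ∃ b ∈ μ.cells,
    T.1 a.1 a.2 = (i : ℕ) ∧ T.1 b.1 b.2 = (i : ℕ) + 1 ∧ a.1 < b.1}

/-- The descent composition of a standard tableau with `n` cells. With entries numbered from `0`,
the descents `d₁ < ⋯ < d_k` give the composition `(d₁ + 1, d₂ - d₁, …, n - 1 - d_k)`, whose partial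
sums are `d₁ + 1, …, d_k + 1, n`. -/
def desComp {μ : YoungDiagram} (T : SYT μ) : Comp :=
  ⟨μ.card, ((compositionAsSetEquiv μ.card).symm (descents T)).toComposition⟩

/-- The coefficients of `∑_{T ∈ SYT(μ)} F_{DesComp(T)}`. -/
def desCoeffs (R : Type*) [CommRing R] (μ : YoungDiagram) : Comp →₀ R :=
  ∑ T : SYT μ, Finsupp.single (desComp T) 1

open Classical in
/-- One round of the peeling algorithm, acting on pairs `(S, g)`, where `S` holds the coefficients
of an `F`-expansion and `g` those of a Schur expansion. If the leading composition `α` of `S` is a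
partition, replace `S` by `S - S_α ∑_{T ∈ SYT(α)} F_{DesComp(T)}` and `g` by `g + S_α s_α`. If `S`
is zero, or if its leading composition is not a partition, the pair stays as it is. -/
def peel {R : Type*} [CommRing R] (p : (Comp →₀ R) × (YoungDiagram →₀ R)) :
    (Comp →₀ R) × (YoungDiagram →₀ R) :=
  if h : ∃ α : Comp, IsLeading p.1 α ∧ α.IsPartition then
    let α := h.choose
    let μ := α.diagram h.choose_spec.2
    (p.1 - p.1 α • desCoeffs R μ, p.2 + Finsupp.single μ (p.1 α))
  else p

end

end QSym

/-!
Every statement is read off from the coefficients of the monomials whose exponents are the parts of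
a composition `γ`, listed in the order of the variables (`ofList γ.parts`).

*Leading terms.* In `∑ c_β F_β` the coefficient of the monomial of `γ` is the sum of the `c_β` over
those `β` that `γ` refines, and a refinement is lexicographically smaller than what it refines
(`ListRefines.le`). So if `α` is the leading composition, the monomial of `α` has coefficient `c_α`
and larger monomials do not occur (`IsLeading.coeff_parts`, `IsLeading.le_parts`). If the function
is symmetric, rearranging exponents does not change coefficients, so `α` is weakly decreasing
(`IsLeading.isPartition`). In the Schur function of `μ` the monomial of `μ` is the largest one that
occurs and its coefficient is `1`: the entries smaller than `k` of a semistandard tableau lie in the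
first `k` rows (`le_rowLens_of_weight`, `card_weight_rowLens`). Hence the coefficient of `s_α` in any
Schur expansion of the function is `c_α` (`IsLeading.eq_coeff_schur`), and subtracting `c_α s_α` just
deletes that term.

*Schur functions.* Two facts about them are needed. The first is Gessel's expansion
`s_μ = ∑_T F_{DesComp(T)}` (`schur_eq_sumF`), which turns Schur-positivity into `F`-positivity and
shows that a round of the algorithm subtracts a multiple of a Schur function. It follows from
standardization (`card_weight_eq`). The second is that `s_μ` is symmetric (`isSymmetric_schur`), so
that the algorithm stays among the symmetric functions. As `s_μ` is quasisymmetric by the first fact,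
only adjacent variables have to be exchanged (`isSymmetric_sumF`), and this is done by the
Bender–Knuth involution. It is defined on Gelfand–Tsetlin patterns, where it reflects each entry of
one level in the interval of its admissible values (`GTPattern.bk`, `GTPattern.size_bk_self`).

*Termination.* A round of the algorithm cancels the leading term and creates only smaller ones
(`IsLeading.parts_lt`), all of whose sizes already occurred, so that only finitely many compositions
can become leading (`exists_iterate_peel`).
-/

namespace QSym

/-! ### Lists: partial sums, refinement and the lexicographic order -/

/-- `s` is the sum of an initial segment of `l`. -/
def IsPrefixSum (l : List ℕ) (s : ℕ) : Prop := ∃ j, (l.take j).sum = s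

theorem IsPrefixSum.zero (l : List ℕ) : IsPrefixSum l 0 := ⟨0, by simp⟩

theorem IsPrefixSum.sum (l : List ℕ) : IsPrefixSum l l.sum := ⟨l.length, by simp⟩

theorem isPrefixSum_nil {s : ℕ} : IsPrefixSum [] s ↔ s = 0 := by
  simp [IsPrefixSum, eq_comm]

theorem isPrefixSum_cons {x : ℕ} {l : List ℕ} {s : ℕ} :
    IsPrefixSum (x :: l) s ↔ s = 0 ∨ ∃ t, IsPrefixSum l t ∧ s = x + t := by
  constructor
  · rintro ⟨_ | j, rfl⟩
    · simp
    · exact Or.inr ⟨_, ⟨j, rfl⟩, by simp⟩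
  · rintro (rfl | ⟨t, ⟨j, rfl⟩, rfl⟩)
    · exact .zero _
    · exact ⟨j + 1, by simp⟩

theorem IsPrefixSum.le_sum {l : List ℕ} {s : ℕ} (h : IsPrefixSum l s) : s ≤ l.sum := by
  obtain ⟨j, rfl⟩ := h
  exact (List.take_sublist j l).sum_le_sum (by simp)

theorem isPrefixSum_append {p q : List ℕ} {s : ℕ} :
    IsPrefixSum (p ++ q) s ↔ IsPrefixSum p s ∨ ∃ t, IsPrefixSum q t ∧ s = p.sum + t := by
  induction p generalizing s with
  | nil =>
    simp only [List.nil_append, isPrefixSum_nil, List.sum_nil, zero_add, exists_eq_right']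
    exact ⟨Or.inr, fun h => h.elim (fun h => h ▸ .zero _) id⟩
  | cons x p ih =>
    simp only [List.cons_append, isPrefixSum_cons, ih, List.sum_cons]
    constructor
    · rintro (h | ⟨t, h | ⟨u, hu, rfl⟩, rfl⟩)
      · exact .inl (.inl h)
      · exact .inl (.inr ⟨t, h, rfl⟩)
      · exact .inr ⟨u, hu, by omega⟩
    · rintro ((h | ⟨t, h, rfl⟩) | ⟨u, hu, rfl⟩)
      · exact .inl h
      · exact .inr ⟨t, .inl h, rfl⟩
      · exact .inr ⟨_, .inr ⟨u, hu, rfl⟩, by omega⟩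

theorem isPrefixSum_filter_ne_zero {l : List ℕ} {s : ℕ} :
    IsPrefixSum (l.filter (· ≠ 0)) s ↔ IsPrefixSum l s := by
  induction l generalizing s with
  | nil => rfl
  | cons x l ih =>
    by_cases hx : x = 0
    · subst hx
      rw [List.filter_cons_of_neg (by simp), ih, isPrefixSum_cons]
      simp only [zero_add, exists_eq_right']
      exact ⟨Or.inr, fun h => h.elim (fun h => h ▸ .zero _) id⟩
    · rw [List.filter_cons_of_pos (by simpa using hx), isPrefixSum_cons, isPrefixSum_cons]
      simp only [ih]

/-- Refinement for lists: `a` is obtained from `b` by summing groups of adjacent entries. -/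
def ListRefines (b a : List ℕ) : Prop :=
  ∃ L : List (List ℕ), L.flatten = b ∧ L.map List.sum = a

theorem ListRefines.sum_eq {b a : List ℕ} (h : ListRefines b a) : b.sum = a.sum := by
  obtain ⟨L, rfl, rfl⟩ := h
  simp [List.sum_flatten]

theorem ListRefines.refl (a : List ℕ) : ListRefines a a :=
  ⟨a.map fun x => [x], by simp [← List.flatMap_def], by simp [Function.comp_def]⟩

/-- A composition refines another one exactly when it has the same sum and its partial sums
include those of the other. -/
theorem listRefines_iff {b a : List ℕ} (hb : ∀ x ∈ b, 0 < x) :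
    ListRefines b a ↔ b.sum = a.sum ∧ ∀ s, IsPrefixSum a s → IsPrefixSum b s := by
  constructor
  · refine fun h => ⟨h.sum_eq, ?_⟩
    obtain ⟨L, rfl, rfl⟩ := h
    clear hb
    induction L with
    | nil => simp
    | cons p L ih =>
      intro s
      simp only [List.map_cons, isPrefixSum_cons, List.flatten_cons, isPrefixSum_append]
      rintro (rfl | ⟨t, ht, rfl⟩)
      · exact .inl (.zero _)
      · exact .inr ⟨t, ih t ht, rfl⟩
  · induction a generalizing b with
    | nil =>
      rintro ⟨h, -⟩
      have : b = [] := by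
        rw [List.eq_nil_iff_forall_not_mem]
        intro x hx
        have := List.single_le_sum (by simp) x hx
        have := hb x hx
        simp at h
        omega
      exact this ▸ .refl _
    | cons x a ih =>
      rintro ⟨h, hs⟩
      obtain ⟨j, hj⟩ := hs x (isPrefixSum_cons.2 (.inr ⟨0, .zero _, rfl⟩))
      obtain ⟨p, q, rfl, rfl⟩ : ∃ p q, b = p ++ q ∧ p.sum = x :=
        ⟨_, _, (List.take_append_drop j b).symm, hj⟩
      obtain ⟨L, rfl, rfl⟩ := ih (b := q) (fun y hy => hb y (by simp [hy])) ⟨by simpa using h, by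
        intro s h1
        rcases isPrefixSum_append.1 (hs _ (isPrefixSum_cons.2 (.inr ⟨s, h1, rfl⟩))) with h2 | h2
        · have := h2.le_sum
          obtain rfl : s = 0 := by omega
          exact .zero _
        · obtain ⟨t, ht, h3⟩ := h2
          obtain rfl : s = t := by omega
          exact ht⟩
      exact ⟨p :: L, rfl, rfl⟩

theorem nil_le_list (l : List ℕ) : [] ≤ l := by
  rcases l with _ | ⟨x, l⟩
  · exact le_rfl
  · exact le_of_lt List.Lex.nil

theorem cons_le_cons_of_lt {x y : ℕ} (l l' : List ℕ) (h : x < y) : x :: l ≤ y :: l' :=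
  le_of_lt (List.Lex.rel h)

theorem ListRefines.le {b a : List ℕ} (hb : ∀ x ∈ b, 0 < x) (ha : ∀ x ∈ a, 0 < x)
    (h : ListRefines b a) : b ≤ a := by
  obtain ⟨L, rfl, rfl⟩ := h
  induction L with
  | nil => exact le_rfl
  | cons p L ih =>
    rcases p with _ | ⟨x, p⟩
    · simp at ha
    rcases p with _ | ⟨y, p⟩
    · simp only [List.flatten_cons, List.map_cons, List.cons_append, List.nil_append,
        List.sum_singleton]
      exact List.cons_le_cons _
        (ih (fun z hz => hb z (by simp [hz])) fun z hz => ha z (List.mem_cons_of_mem _ hz))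
    · have := hb y (by simp)
      simp only [List.flatten_cons, List.map_cons, List.cons_append, List.sum_cons]
      exact cons_le_cons_of_lt _ _ (by omega)

/-- Dominance implies the lexicographic order. -/
theorem le_of_take_sum_le {a b : List ℕ} (ha : ∀ x ∈ a, 0 < x)
    (h : ∀ k, (a.take k).sum ≤ (b.take k).sum) : a ≤ b := by
  induction a generalizing b with
  | nil => exact nil_le_list b
  | cons x a ih =>
    have h1 := h 1
    have hx := ha x (by simp)
    rcases b with _ | ⟨y, b⟩
    · simp at h1
      omega
    simp only [List.take_succ_cons, List.take_zero, List.sum_singleton] at h1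
    rcases h1.lt_or_eq with h1 | rfl
    · exact cons_le_cons_of_lt _ _ h1
    · refine List.cons_le_cons _ (ih (fun z hz => ha z (by simp [hz])) fun k => ?_)
      simpa using h (k + 1)

/-- A list that is not weakly decreasing has a lexicographically larger rearrangement. -/
theorem exists_perm_lt {l : List ℕ} (h : ¬ l.SortedGE) : ∃ l', l.Perm l' ∧ l < l' := by
  induction l with
  | nil => exact absurd (List.sortedGE_iff_pairwise.2 .nil) h
  | cons x l ih =>
    by_cases hl : l.SortedGE
    · rw [List.sortedGE_iff_pairwise] at h hl
      rw [List.pairwise_cons] at h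
      push Not at h
      have : ∃ y ∈ l, x < y := by
        by_contra! hc
        exact h hc hl
      obtain ⟨y, hy, hxy⟩ := this
      refine ⟨y :: x :: l.erase y, ?_, List.Lex.rel hxy⟩
      exact ((List.perm_cons_erase hy).cons x).trans (.swap _ _ _)
    · obtain ⟨l', h1, h2⟩ := ih hl
      exact ⟨x :: l', h1.cons x, List.Lex.cons h2⟩

/-! ### Exponent vectors -/

/-- The exponent vector whose entries are those of the list `l`, followed by zeros. -/
noncomputable def ofList (l : List ℕ) : ℕ →₀ ℕ :=
  Finsupp.onFinset (Finset.range l.length) (fun i => l.getD i 0) (by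
    intro i hi
    by_contra h
    simp only [Finset.mem_range, not_lt] at h
    simp [h] at hi)

@[simp]
theorem ofList_apply (l : List ℕ) (i : ℕ) : ofList l i = l.getD i 0 := rfl

theorem sum_range_ofList (l : List ℕ) (k : ℕ) :
    ∑ i ∈ Finset.range k, ofList l i = (l.take k).sum := by
  induction k generalizing l with
  | zero => simp
  | succ k ih =>
    rcases l with _ | ⟨x, l⟩
    · simp
    · rw [Finset.sum_range_succ']
      have := ih l
      simp only [ofList_apply, List.getD_eq_getElem?_getD] at this
      simp [this, add_comm]

theorem exponents_eq_filter {m : ℕ →₀ ℕ} {N : ℕ} (hN : ∀ i, m i ≠ 0 → i < N) :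
    exponents m = ((List.range N).map m).filter (· ≠ 0) := by
  have : m.support.sort (· ≤ ·) = (List.range N).filter (fun i => m i ≠ 0) := by
    refine List.Perm.eq_of_sortedLE (Finset.sortedLT_sort _).sortedLE ?_ ?_
    · exact (List.Pairwise.filter _ List.pairwise_le_range).sortedLE
    · rw [List.perm_ext_iff_of_nodup (Finset.sort_nodup _ _) (List.nodup_range.filter _)]
      intro i
      simpa using hN i
  rw [exponents, this, List.filter_map]
  rfl

theorem exists_bound (m : ℕ →₀ ℕ) : ∃ N, ∀ i, m i ≠ 0 → i < N := by
  obtain ⟨N, hN⟩ := m.support.exists_nat_subset_range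
  exact ⟨N, fun i hi => Finset.mem_range.1 (hN (Finsupp.mem_support_iff.2 hi))⟩

theorem exponents_pos {m : ℕ →₀ ℕ} {x : ℕ} (hx : x ∈ exponents m) : 0 < x := by
  obtain ⟨N, hN⟩ := exists_bound m
  rw [exponents_eq_filter hN] at hx
  simp at hx
  omega

theorem exponents_ofList {l : List ℕ} (hl : ∀ x ∈ l, 0 < x) : exponents (ofList l) = l := by
  rw [exponents_eq_filter (N := l.length)]
  · have : (List.range l.length).map (ofList l) = l :=
      List.ext_getElem (by simp) fun i h1 h2 => by simp [h2]
    rw [this, List.filter_eq_self]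
    intro x hx
    have := hl x hx
    simp only [ne_eq, decide_not, Bool.not_eq_eq_eq_not, Bool.not_true, decide_eq_false_iff_not]
    omega
  · intro i hi
    by_contra h
    simp only [not_lt] at h
    simp [h] at hi

theorem exponents_perm_mapDomain (m : ℕ →₀ ℕ) (σ : Equiv.Perm ℕ) :
    (exponents (m.mapDomain σ)).Perm (exponents m) := by
  rw [← Multiset.coe_eq_coe]
  simp only [exponents, ← Multiset.map_coe, Finset.sort_eq]
  have : (m.mapDomain σ).support = m.support.map σ.toEmbedding := by
    rw [← Finsupp.equivMapDomain_eq_mapDomain]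
    rfl
  rw [this]
  simp [← Finsupp.equivMapDomain_eq_mapDomain]

theorem sum_map_range (m : ℕ → ℕ) (N : ℕ) :
    ((List.range N).map m).sum = ∑ i ∈ Finset.range N, m i := by
  induction N with
  | zero => rfl
  | succ N ih => simp [List.range_succ, Finset.sum_range_succ, ih]

theorem sum_exponents {m : ℕ →₀ ℕ} {N : ℕ} (hN : ∀ i, m i ≠ 0 → i < N) :
    (exponents m).sum = ∑ i ∈ Finset.range N, m i := by
  have key : ∀ l : List ℕ, (l.filter (· ≠ 0)).sum = l.sum := by
    intro l
    induction l with
    | nil => rfl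
    | cons x l ih => by_cases hx : x = 0 <;> simp_all
  rw [exponents_eq_filter hN, key, sum_map_range]

theorem isPrefixSum_exponents {m : ℕ →₀ ℕ} {s : ℕ} :
    IsPrefixSum (exponents m) s ↔ ∃ k, ∑ i ∈ Finset.range k, m i = s := by
  obtain ⟨N, hN⟩ := exists_bound m
  have key : ∀ j, (((List.range N).map m).take j).sum = ∑ i ∈ Finset.range (min j N), m i := by
    intro j
    rw [← List.map_take, List.take_range, sum_map_range]
  rw [exponents_eq_filter hN, isPrefixSum_filter_ne_zero]
  constructor
  · rintro ⟨j, rfl⟩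
    exact ⟨_, (key j).symm⟩
  · rintro ⟨k, rfl⟩
    refine ⟨k, (key k).trans ?_⟩
    refine Finset.sum_subset (by simp) fun i hi hi' => ?_
    simp only [Finset.mem_range, lt_inf_iff, not_and, not_lt] at hi hi'
    by_contra h
    exact absurd (hi' hi) (not_le.2 (hN i h))

/-! ### Coefficients of fundamental quasisymmetric functions and symmetry -/

open Classical in
theorem coeff_fundamental (R : Type*) [CommRing R] (α : Comp) (m : ℕ →₀ ℕ) :
    MvPowerSeries.coeff m (fundamental R α) =
      if ListRefines (exponents m) α.parts then 1 else 0 := by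
  have h1 : MvPowerSeries.coeff m (fundamental R α) =
      ∑ β : Composition α.1 with Refines β α.2, if exponents m = β.blocks then (1 : R) else 0 := by
    rw [fundamental, map_sum]
    rfl
  rw [h1]
  split_ifs with h
  · let β : Composition α.1 := ⟨exponents m, exponents_pos, by rw [h.sum_eq, α.2.blocks_sum]⟩
    rw [Finset.sum_eq_single_of_mem β (Finset.mem_filter.2 ⟨Finset.mem_univ _, h⟩)]
    · simp [β]
    · intro γ _ hγ
      rw [if_neg]
      intro h2
      exact hγ (Composition.ext h2.symm)
  · refine Finset.sum_eq_zero fun β hβ => ?_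
    rw [if_neg]
    intro h2
    exact h (h2 ▸ (Finset.mem_filter.1 hβ).2)

open Classical in
theorem coeff_sumF {R : Type*} [CommRing R] (c : Comp →₀ R) (m : ℕ →₀ ℕ) :
    MvPowerSeries.coeff m (sumF c) =
      ∑ β ∈ c.support, if ListRefines (exponents m) β.parts then c β else 0 := by
  rw [sumF, Finsupp.sum, map_sum]
  refine Finset.sum_congr rfl fun β _ => ?_
  rw [MvPowerSeries.coeff_smul, coeff_fundamental]
  split_ifs <;> simp

theorem coeff_sumF_ofList_exponents {R : Type*} [CommRing R] (c : Comp →₀ R) (m : ℕ →₀ ℕ) :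
    MvPowerSeries.coeff (ofList (exponents m)) (sumF c) = MvPowerSeries.coeff m (sumF c) := by
  classical
  rw [coeff_sumF, coeff_sumF, exponents_ofList fun x hx => exponents_pos hx]

/-- A function of exponent vectors which is invariant under exchanging adjacent variables takes
the same value on lists which are rearrangements of each other. -/
theorem eq_of_perm {X : Type*} {g : (ℕ →₀ ℕ) → X}
    (hg : ∀ i m, g (m.mapDomain (Equiv.swap i (i + 1))) = g m) {l l' : List ℕ} (h : l.Perm l') :
    g (ofList l) = g (ofList l') := by
  suffices ∀ p : List ℕ, g (ofList (p ++ l)) = g (ofList (p ++ l')) by simpa using this []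
  induction h with
  | nil => exact fun _ => rfl
  | cons x _ ih => exact fun p => by simpa using ih (p ++ [x])
  | trans _ _ ih1 ih2 => exact fun p => (ih1 p).trans (ih2 p)
  | swap x y l =>
    intro p
    rw [← hg p.length]
    congr 1
    ext i
    rw [← Finsupp.equivMapDomain_eq_mapDomain, Finsupp.equivMapDomain_apply, Equiv.symm_swap,
      ofList_apply, ofList_apply]
    have hp : ∀ (z w : ℕ) (j : ℕ), (p ++ z :: w :: l).getD j 0 =
        if j < p.length then p.getD j 0 else if j = p.length then z else
          if j = p.length + 1 then w else l.getD (j - p.length - 2) 0 := by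
      intro z w j
      simp only [List.getD_eq_getElem?_getD]
      rcases lt_or_ge j p.length with h | h
      · rw [List.getElem?_append_left h, if_pos h]
      · rw [List.getElem?_append_right h, if_neg (by omega)]
        obtain ⟨d, rfl⟩ := Nat.exists_eq_add_of_le h
        rcases d with _ | _ | d <;> simp
    rw [hp, hp]
    rcases eq_or_ne i p.length with rfl | h1
    · simp
    rcases eq_or_ne i (p.length + 1) with rfl | h2
    · simp
    rw [Equiv.swap_apply_of_ne_of_ne h1 h2]
    simp [h1, h2]

/-- A quasisymmetric function is symmetric as soon as it is invariant under exchanging adjacent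
variables. -/
theorem isSymmetric_sumF {R : Type*} [CommRing R] (c : Comp →₀ R)
    (h : ∀ i m, MvPowerSeries.coeff (m.mapDomain (Equiv.swap i (i + 1))) (sumF c) =
      MvPowerSeries.coeff m (sumF c)) :
    IsSymmetric (sumF c) := by
  intro σ m
  rw [← coeff_sumF_ofList_exponents, ← coeff_sumF_ofList_exponents c m]
  exact eq_of_perm (g := fun m => MvPowerSeries.coeff m (sumF c)) h
    (exponents_perm_mapDomain m σ)

theorem isPrefixSum_blocks {n : ℕ} (c : Composition n) (s : Fin (n + 1)) :
    IsPrefixSum c.blocks s ↔ s ∈ c.boundaries := by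
  simp only [Composition.boundaries, Finset.mem_map, Finset.mem_univ, true_and,
    Composition.boundary, RelEmbedding.coe_toEmbedding, OrderEmbedding.coe_ofStrictMono]
  constructor
  · rintro ⟨j, hj⟩
    rcases le_total j c.length with h | h
    · exact ⟨⟨j, by omega⟩, Fin.ext hj⟩
    · exact ⟨Fin.last _, Fin.ext ((c.sizeUpTo_length.trans (c.sizeUpTo_ofLength_le _ h).symm).trans
        hj)⟩
  · rintro ⟨j, rfl⟩
    exact ⟨j, rfl⟩

theorem isPrefixSum_desComp {μ : YoungDiagram} (T : SYT μ) (s : ℕ) :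
    IsPrefixSum (desComp T).parts s ↔ s = 0 ∨ s = μ.card ∨ ∃ d ∈ descents T, s = (d : ℕ) + 1 := by
  have hb : ∀ s : Fin (μ.card + 1), IsPrefixSum (desComp T).parts s ↔
      s = 0 ∨ s = Fin.last _ ∨ ∃ d, ∃ _ : d ∈ descents T, (s : ℕ) = d + 1 := by
    intro s
    refine (isPrefixSum_blocks (desComp T).2 s).trans ?_
    change s ∈ ((compositionAsSetEquiv μ.card).symm (descents T)).toComposition.boundaries ↔ _
    rw [CompositionAsSet.toComposition_boundaries]
    exact Set.mem_toFinset
  constructor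
  · intro h
    have hs : s ≤ μ.card := h.le_sum.trans_eq (desComp T).2.blocks_sum
    simpa [Fin.ext_iff] using (hb ⟨s, Nat.lt_succ_of_le hs⟩).1 h
  · intro h
    have hs : s ≤ μ.card := by
      rcases h with rfl | rfl | ⟨d, -, rfl⟩ <;> omega
    refine (hb ⟨s, Nat.lt_succ_of_le hs⟩).2 ?_
    simpa [Fin.ext_iff] using h

/-! ### Semistandard tableaux and their weights -/

variable {μ : YoungDiagram}

theorem weight_apply (U : SemistandardYoungTableau μ) (i : ℕ) :
    weight U i = (μ.cells.filter fun c => U c.1 c.2 = i).card := by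
  rw [weight, Finsupp.finsetSum_apply, Finset.card_filter]
  exact Finset.sum_congr rfl fun c _ => Finsupp.single_apply

theorem sum_range_weight (U : SemistandardYoungTableau μ) (k : ℕ) :
    ∑ i ∈ Finset.range k, weight U i = (μ.cells.filter fun c => U c.1 c.2 < k).card := by
  rw [Finset.card_eq_sum_card_fiberwise (f := fun c => U c.1 c.2) (t := Finset.range k)]
  · refine Finset.sum_congr rfl fun i hi => ?_
    rw [weight_apply, Finset.filter_filter]
    congr 1
    refine Finset.filter_congr fun c _ => ?_
    simp only [Finset.mem_range] at hi
    exact ⟨fun h => ⟨h ▸ hi, h⟩, And.right⟩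
  · intro c hc
    simpa using (Finset.mem_filter.1 hc).2

theorem eq_of_sum_range_eq {m m' : ℕ → ℕ}
    (h : ∀ k, ∑ i ∈ Finset.range k, m i = ∑ i ∈ Finset.range k, m' i) : m = m' := by
  ext k
  have h1 := h k
  have h2 := h (k + 1)
  rw [Finset.sum_range_succ, Finset.sum_range_succ] at h2
  omega

theorem weight_eq_iff (U : SemistandardYoungTableau μ) (m : ℕ →₀ ℕ) :
    weight U = m ↔
      ∀ k, (μ.cells.filter fun c => U c.1 c.2 < k).card = ∑ i ∈ Finset.range k, m i := by
  simp only [← sum_range_weight]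
  constructor
  · rintro rfl k
    rfl
  · exact fun h => DFunLike.coe_injective (eq_of_sum_range_eq h)

theorem row_le_entry (U : SemistandardYoungTableau μ) {i j : ℕ} (h : (i, j) ∈ μ) : i ≤ U i j := by
  induction i with
  | zero => exact Nat.zero_le _
  | succ i ih =>
    have := ih (μ.up_left_mem (Nat.le_succ i) le_rfl h)
    have := U.col_strict (Nat.lt_add_one i) h
    omega

theorem getD_rowLens (i : ℕ) : μ.rowLens.getD i 0 = μ.rowLen i := by
  rcases lt_or_ge i (μ.colLen 0) with h | h
  · simp [YoungDiagram.rowLens, h]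
  · have : μ.rowLen i = 0 := by
      by_contra h0
      have : (i, 0) ∈ μ := YoungDiagram.mem_iff_lt_rowLen.2 (Nat.pos_of_ne_zero h0)
      rw [YoungDiagram.mem_iff_lt_colLen] at this
      omega
    simp [YoungDiagram.rowLens, h, this]

theorem card_cells_row_lt (k : ℕ) :
    (μ.cells.filter fun c => c.1 < k).card = (μ.rowLens.take k).sum := by
  rw [← sum_range_ofList,
    Finset.card_eq_sum_card_fiberwise (f := fun c => c.1) (t := Finset.range k)]
  · refine Finset.sum_congr rfl fun i hi => ?_
    rw [ofList_apply, getD_rowLens, YoungDiagram.rowLen_eq_card, YoungDiagram.row,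
      Finset.filter_filter]
    congr 1
    refine Finset.filter_congr fun c _ => ?_
    simp only [Finset.mem_range] at hi
    exact ⟨And.right, fun h => ⟨h ▸ hi, h⟩⟩
  · intro c hc
    simpa using (Finset.mem_filter.1 hc).2

theorem cells_lt_subset (U : SemistandardYoungTableau μ) (k : ℕ) :
    (μ.cells.filter fun c => U c.1 c.2 < k) ⊆ μ.cells.filter fun c => c.1 < k := by
  intro c hc
  rw [Finset.mem_filter] at hc ⊢
  exact ⟨hc.1, (row_le_entry U hc.1).trans_lt hc.2⟩

/-- The entries smaller than `k` of a semistandard tableau lie in its first `k` rows. Hence the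
weight is dominated by the shape. -/
theorem le_rowLens_of_weight {l : List ℕ} (hl : ∀ x ∈ l, 0 < x) (U : SemistandardYoungTableau μ)
    (hU : weight U = ofList l) : l ≤ μ.rowLens := by
  refine le_of_take_sum_le hl fun k => ?_
  rw [← sum_range_ofList, ← (weight_eq_iff U _).1 hU, ← card_cells_row_lt]
  exact Finset.card_le_card (cells_lt_subset U k)

/-- There is exactly one semistandard tableau whose weight is its shape, namely the one whose
`i`-th row is filled with `i`. -/
theorem card_weight_rowLens (μ : YoungDiagram) :
    Nat.card {U : SemistandardYoungTableau μ // weight U = ofList μ.rowLens} = 1 := by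
  rw [Nat.card_eq_one_iff_unique]
  constructor
  · have key : ∀ U : SemistandardYoungTableau μ, weight U = ofList μ.rowLens →
        U = .highestWeight μ := by
      intro U hU
      ext i j
      rw [SemistandardYoungTableau.highestWeight_apply]
      split_ifs with h
      · refine le_antisymm ?_ (row_le_entry U h)
        have h1 := Finset.eq_of_subset_of_card_le (cells_lt_subset U (i + 1)) (by
          rw [card_cells_row_lt, (weight_eq_iff U _).1 hU, sum_range_ofList])
        have h2 : (i, j) ∈ μ.cells.filter fun c => c.1 < i + 1 := by simpa using h
        rw [← h1, Finset.mem_filter] at h2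
        exact Nat.lt_succ_iff.1 h2.2
      · exact U.zeros h
    exact ⟨fun U U' => Subtype.ext ((key _ U.2).trans (key _ U'.2).symm)⟩
  · refine ⟨.highestWeight μ, (weight_eq_iff _ _).2 fun k => ?_⟩
    rw [sum_range_ofList, ← card_cells_row_lt]
    congr 1
    refine Finset.filter_congr fun c hc => ?_
    rw [SemistandardYoungTableau.highestWeight_apply, if_pos (show (c.1, c.2) ∈ μ from hc)]

/-! ### Gelfand–Tsetlin patterns and the Bender–Knuth involution -/

/-- A Gelfand–Tsetlin pattern of shape `μ`. It encodes the semistandard tableau whose row `r`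
contains `G k r` entries smaller than `k`: the `k`-th level is the shape formed by these entries,
and the inequalities say that consecutive levels differ by a horizontal strip. -/
@[ext]
structure GTPattern (μ : YoungDiagram) where
  /-- The number of entries smaller than `k` in row `r`. -/
  G : ℕ → ℕ → ℕ
  zero : ∀ r, G 0 r = 0
  lower : ∀ k r, G (k + 1) (r + 1) ≤ G k r
  upper : ∀ k r, G k r ≤ G (k + 1) r
  stable : ∃ N, ∀ k, N ≤ k → ∀ r, G k r = μ.rowLen r

namespace GTPattern

theorem mono (P : GTPattern μ) (r : ℕ) : Monotone fun k => P.G k r :=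
  monotone_nat_of_le_succ fun k => P.upper k r

theorem anti (P : GTPattern μ) (k : ℕ) : Antitone (P.G k) :=
  antitone_nat_of_succ_le fun r => (P.upper k (r + 1)).trans (P.lower k r)

theorem le_rowLen (P : GTPattern μ) (k r : ℕ) : P.G k r ≤ μ.rowLen r := by
  obtain ⟨N, hN⟩ := P.stable
  rw [← hN (max k N) (le_max_right _ _) r]
  exact P.mono r (le_max_left _ _)

theorem eq_zero (P : GTPattern μ) (k : ℕ) {r : ℕ} (hr : μ.colLen 0 ≤ r) : P.G k r = 0 := by
  have h1 := P.le_rowLen k r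
  by_contra h0
  have : (r, 0) ∈ μ := YoungDiagram.mem_iff_lt_rowLen.2 (by omega)
  rw [YoungDiagram.mem_iff_lt_colLen] at this
  omega

/-- The number of cells in level `k`. -/
def size (P : GTPattern μ) (k : ℕ) : ℕ := ∑ r ∈ Finset.range (μ.colLen 0), P.G k r

/-- The smallest value that the pattern inequalities allow in row `r` of a level with lower
neighbour `A` and upper neighbour `B`. -/
def lo (A B : ℕ → ℕ) (r : ℕ) : ℕ := max (A r) (B (r + 1))

/-- The largest value that the pattern inequalities allow in row `r` of a level with lower
neighbour `A` and upper neighbour `B`. -/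
def hi (A B : ℕ → ℕ) : ℕ → ℕ
  | 0 => B 0
  | r + 1 => min (B (r + 1)) (A r)

theorem lo_le (P : GTPattern μ) (k r : ℕ) : lo (P.G k) (P.G (k + 2)) r ≤ P.G (k + 1) r :=
  max_le (P.upper k r) (P.lower (k + 1) r)

theorem le_hi (P : GTPattern μ) (k r : ℕ) : P.G (k + 1) r ≤ hi (P.G k) (P.G (k + 2)) r := by
  rcases r with _ | r
  · exact P.upper (k + 1) 0
  · exact le_min (P.upper (k + 1) (r + 1)) (P.lower k r)

theorem hi_le (A B : ℕ → ℕ) (r : ℕ) : hi A B r ≤ B r := by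
  rcases r with _ | r
  · exact le_rfl
  · exact min_le_left _ _

/-- The Bender–Knuth involution: each entry of level `i + 1` is reflected in the interval of values
that the two neighbouring levels allow. -/
def bk (i : ℕ) (P : GTPattern μ) : GTPattern μ where
  G k r := if k = i + 1 then lo (P.G i) (P.G (i + 2)) r + hi (P.G i) (P.G (i + 2)) r - P.G (i + 1) r
    else P.G k r
  zero r := by simpa using P.zero r
  lower k r := by
    have h1 := P.lo_le i r
    have h2 := P.le_hi i r
    have h3 := P.lo_le i (r + 1)
    have h4 : hi (P.G i) (P.G (i + 2)) (r + 1) ≤ P.G i r := min_le_right _ _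
    have h5 : P.G (i + 2) (r + 1) ≤ lo (P.G i) (P.G (i + 2)) r := le_max_right _ _
    split_ifs with h h' h'
    · omega
    · obtain rfl : k = i := by omega
      omega
    · subst h'
      change P.G (i + 2) (r + 1) ≤ _
      omega
    · exact P.lower k r
  upper k r := by
    have h1 := P.lo_le i r
    have h2 := P.le_hi i r
    have h3 := hi_le (P.G i) (P.G (i + 2)) r
    have h4 : P.G i r ≤ lo (P.G i) (P.G (i + 2)) r := le_max_left _ _
    split_ifs with h h' h'
    · omega
    · subst h
      change _ ≤ P.G (i + 2) r
      omega
    · obtain rfl : k = i := by omega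
      omega
    · exact P.upper k r
  stable := by
    obtain ⟨N, hN⟩ := P.stable
    refine ⟨max N (i + 2), fun k hk r => ?_⟩
    have h1 : N ≤ k := (le_max_left _ _).trans hk
    have h2 : i + 2 ≤ k := (le_max_right _ _).trans hk
    rw [if_neg (by omega)]
    exact hN k h1 r

theorem bk_of_ne {i k : ℕ} (h : k ≠ i + 1) (P : GTPattern μ) : (P.bk i).G k = P.G k :=
  funext fun _ => if_neg h

theorem bk_self (i : ℕ) (P : GTPattern μ) (r : ℕ) : (P.bk i).G (i + 1) r =
    lo (P.G i) (P.G (i + 2)) r + hi (P.G i) (P.G (i + 2)) r - P.G (i + 1) r :=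
  if_pos rfl

theorem bk_bk (i : ℕ) (P : GTPattern μ) : (P.bk i).bk i = P := by
  ext k r
  by_cases h : k = i + 1
  · subst h
    rw [bk_self, bk_self, bk_of_ne (by omega), bk_of_ne (by omega)]
    have h1 := P.lo_le i r
    have h2 := P.le_hi i r
    omega
  · rw [bk_of_ne h, bk_of_ne h]

/-- Pairing the lower bound of each row with the upper bound of the next one turns every maximum
and minimum into a sum. -/
theorem sum_lo_add_hi (A B : ℕ → ℕ) (L : ℕ) :
    ∑ r ∈ Finset.range L, lo A B r + ∑ r ∈ Finset.range (L + 1), hi A B r =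
      ∑ r ∈ Finset.range L, A r + ∑ r ∈ Finset.range (L + 1), B r := by
  rw [Finset.sum_range_succ', Finset.sum_range_succ', ← add_assoc, ← add_assoc,
    ← Finset.sum_add_distrib, ← Finset.sum_add_distrib]
  congr 1
  refine Finset.sum_congr rfl fun r _ => ?_
  simp only [lo, hi]
  omega

theorem size_bk_self (i : ℕ) (P : GTPattern μ) :
    (P.bk i).size (i + 1) + P.size (i + 1) = P.size i + P.size (i + 2) := by
  have h := sum_lo_add_hi (P.G i) (P.G (i + 2)) (μ.colLen 0)
  have h0 := P.eq_zero (i + 2) (le_refl (μ.colLen 0))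
  have h1 := hi_le (P.G i) (P.G (i + 2)) (μ.colLen 0)
  rw [Finset.sum_range_succ, Finset.sum_range_succ, h0, Nat.le_zero.1 (h1.trans_eq h0), add_zero,
    add_zero, ← Finset.sum_add_distrib] at h
  simp only [size]
  rw [← h, ← Finset.sum_add_distrib]
  refine Finset.sum_congr rfl fun r _ => ?_
  rw [bk_self]
  have h1 := P.lo_le i r
  have h2 := P.le_hi i r
  omega

theorem size_bk_of_ne {i k : ℕ} (h : k ≠ i + 1) (P : GTPattern μ) : (P.bk i).size k = P.size k := by
  rw [size, bk_of_ne h, size]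

theorem exists_lt (P : GTPattern μ) {r j : ℕ} (h : (r, j) ∈ μ) : ∃ k, j < P.G (k + 1) r := by
  obtain ⟨N, hN⟩ := P.stable
  exact ⟨N, by rw [hN _ (Nat.le_succ N)]; exact YoungDiagram.mem_iff_lt_rowLen.1 h⟩

open Classical in
/-- The tableau encoded by a pattern: the entry in column `j` of row `r` is the first `k` for which
row `r` has more than `j` entries `≤ k`. -/
noncomputable def toTableau (P : GTPattern μ) : SemistandardYoungTableau μ where
  entry r j := if h : (r, j) ∈ μ then Nat.find (P.exists_lt h) else 0
  row_weak' := by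
    intro r j1 j2 hj h2
    have h1 := μ.up_left_mem le_rfl hj.le h2
    rw [dif_pos h1, dif_pos h2]
    exact Nat.find_min' _ (hj.trans (Nat.find_spec (P.exists_lt h2)))
  col_strict' := by
    intro r1 r2 j hr h2
    have h1 := μ.up_left_mem hr.le le_rfl h2
    rw [dif_pos h1, dif_pos h2]
    have h3 := Nat.find_spec (P.exists_lt h2)
    generalize Nat.find (P.exists_lt h2) = k at h3
    have h4 : j < P.G k r1 :=
      h3.trans_le ((P.anti (k + 1) (Nat.succ_le_of_lt hr)).trans (P.lower k r1))
    rcases k with _ | k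
    · simp [P.zero] at h4
    · exact Nat.lt_succ_of_le (Nat.find_min' _ h4)
  zeros' h := dif_neg h

theorem toTableau_lt_iff (P : GTPattern μ) {r j : ℕ} (h : (r, j) ∈ μ) (k : ℕ) :
    P.toTableau r j < k ↔ j < P.G k r := by
  classical
  have : P.toTableau r j = Nat.find (P.exists_lt h) := dif_pos h
  rw [this, Nat.find_lt_iff]
  constructor
  · rintro ⟨l, hl, h2⟩
    exact h2.trans_le (P.mono r hl)
  · intro h2
    rcases k with _ | k
    · simp [P.zero] at h2
    · exact ⟨k, Nat.lt_succ_self k, h2⟩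

theorem exists_notMem_or_le (U : SemistandardYoungTableau μ) (k r : ℕ) :
    ∃ j, ¬ ((r, j) ∈ μ ∧ U r j < k) :=
  ⟨μ.rowLen r, fun h => (YoungDiagram.mem_iff_lt_rowLen.1 h.1).false⟩

open Classical in
theorem lt_find_iff (U : SemistandardYoungTableau μ) (k r j : ℕ) :
    j < Nat.find (exists_notMem_or_le U k r) ↔ (r, j) ∈ μ ∧ U r j < k := by
  rw [Nat.lt_find_iff]
  constructor
  · exact fun h => not_not.1 (h j le_rfl)
  · exact fun h i hi => not_not.2 ⟨μ.up_left_mem le_rfl hi h.1,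
      (U.row_weak_of_le hi h.1).trans_lt h.2⟩

open Classical in
/-- The pattern which encodes a tableau. As rows increase weakly, the number of entries smaller
than `k` in row `r` is the first column without such an entry. -/
noncomputable def ofTableau (U : SemistandardYoungTableau μ) : GTPattern μ where
  G k r := Nat.find (exists_notMem_or_le U k r)
  zero r := by simp
  lower k r := by
    refine le_of_forall_lt fun j hj => ?_
    rw [lt_find_iff] at hj ⊢
    refine ⟨μ.up_left_mem (Nat.le_succ r) le_rfl hj.1, ?_⟩
    have := U.col_strict (Nat.lt_add_one r) hj.1
    omega
  upper k r := by
    refine le_of_forall_lt fun j hj => ?_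
    rw [lt_find_iff] at hj ⊢
    exact ⟨hj.1, by omega⟩
  stable := by
    refine ⟨(μ.cells.sup fun c => U c.1 c.2) + 1, fun k hk r => ?_⟩
    refine eq_of_forall_lt_iff fun j => ?_
    rw [lt_find_iff, ← YoungDiagram.mem_iff_lt_rowLen, and_iff_left_iff_imp]
    intro h
    have : U r j ≤ _ := Finset.le_sup (f := fun c : ℕ × ℕ => U c.1 c.2) (b := (r, j)) h
    omega

theorem lt_ofTableau_iff (U : SemistandardYoungTableau μ) (k r j : ℕ) :
    j < (ofTableau U).G k r ↔ (r, j) ∈ μ ∧ U r j < k :=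
  lt_find_iff U k r j

/-- Gelfand–Tsetlin patterns of shape `μ` are the same thing as semistandard tableaux of
shape `μ`. -/
noncomputable def equivTableau : GTPattern μ ≃ SemistandardYoungTableau μ where
  toFun := toTableau
  invFun := ofTableau
  left_inv P := by
    ext k r
    refine eq_of_forall_lt_iff fun j => ?_
    rw [lt_ofTableau_iff]
    constructor
    · rintro ⟨h1, h2⟩
      exact (P.toTableau_lt_iff h1 k).1 h2
    · intro h
      have h1 : (r, j) ∈ μ := YoungDiagram.mem_iff_lt_rowLen.2 (h.trans_le (P.le_rowLen k r))
      exact ⟨h1, (P.toTableau_lt_iff h1 k).2 h⟩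
  right_inv U := by
    ext r j
    by_cases h : (r, j) ∈ μ
    · refine eq_of_forall_gt_iff fun k => ?_
      rw [toTableau_lt_iff _ h, lt_ofTableau_iff, and_iff_right h]
    · rw [SemistandardYoungTableau.zeros _ h, SemistandardYoungTableau.zeros _ h]

theorem size_eq_card (P : GTPattern μ) (k : ℕ) :
    P.size k = (μ.cells.filter fun c => P.toTableau c.1 c.2 < k).card := by
  rw [Finset.card_eq_sum_card_fiberwise (f := Prod.fst) (t := Finset.range (μ.colLen 0))]
  · refine Finset.sum_congr rfl fun r _ => ?_
    rw [← Finset.card_range (P.G k r)]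
    refine Finset.card_nbij' (fun j => (r, j)) Prod.snd ?_ ?_ ?_ ?_
    · intro j hj
      have hj : j < P.G k r := by simpa using hj
      have h1 : (r, j) ∈ μ := YoungDiagram.mem_iff_lt_rowLen.2 (hj.trans_le (P.le_rowLen k r))
      simpa [h1] using (P.toTableau_lt_iff h1 k).2 hj
    · rintro ⟨r', j⟩ hj
      obtain ⟨⟨h1, h2⟩, rfl⟩ : ((r', j) ∈ μ ∧ P.toTableau r' j < k) ∧ r' = r := by simpa using hj
      simpa using (P.toTableau_lt_iff h1 k).1 h2
    · exact fun _ _ => rfl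
    · rintro ⟨r', j⟩ hj
      obtain ⟨-, rfl⟩ : ((r', j) ∈ μ ∧ P.toTableau r' j < k) ∧ r' = r := by simpa using hj
      rfl
  · rintro ⟨r, j⟩ hc
    have h1 : (r, j) ∈ μ := (Finset.mem_filter.1 hc).1
    simpa [← YoungDiagram.mem_iff_lt_colLen] using μ.up_left_mem le_rfl (Nat.zero_le j) h1

theorem weight_toTableau_iff (P : GTPattern μ) (m : ℕ →₀ ℕ) :
    weight P.toTableau = m ↔ ∀ k, P.size k = ∑ i ∈ Finset.range k, m i := by
  simp only [weight_eq_iff, size_eq_card]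

/-- Exchanging two adjacent variables changes a single partial sum of the exponents. -/
theorem sum_range_mapDomain_swap (m : ℕ →₀ ℕ) (i k : ℕ) :
    ∑ j ∈ Finset.range k, m.mapDomain (Equiv.swap i (i + 1)) j =
      if k = i + 1 then ∑ j ∈ Finset.range i, m j + m (i + 1)
      else ∑ j ∈ Finset.range k, m j := by
  have hm : ∀ j, m.mapDomain (Equiv.swap i (i + 1)) j = m (Equiv.swap i (i + 1) j) := fun j => by
    rw [← Finsupp.equivMapDomain_eq_mapDomain, Finsupp.equivMapDomain_apply, Equiv.symm_swap]
  simp only [hm]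
  have hlt : ∀ k ≤ i, ∑ j ∈ Finset.range k, m (Equiv.swap i (i + 1) j) =
      ∑ j ∈ Finset.range k, m j := by
    intro k hk
    refine Finset.sum_congr rfl fun j hj => ?_
    rw [Finset.mem_range] at hj
    rw [Equiv.swap_apply_of_ne_of_ne (by omega) (by omega)]
  induction k with
  | zero => simp
  | succ k ih =>
    rcases lt_trichotomy k i with h | rfl | h
    · rw [if_neg (by omega), hlt _ (by omega)]
    · rw [if_pos rfl, Finset.sum_range_succ, hlt _ le_rfl, Equiv.swap_apply_left]
    · rw [if_neg (by omega), Finset.sum_range_succ, ih]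
      split_ifs with h1
      · subst h1
        rw [Equiv.swap_apply_right, Finset.sum_range_succ, Finset.sum_range_succ]
        omega
      · rw [Equiv.swap_apply_of_ne_of_ne (by omega) (by omega), Finset.sum_range_succ _ k]

theorem size_bk_iff (i : ℕ) (m : ℕ →₀ ℕ) (P : GTPattern μ)
    (h : ∀ k, P.size k = ∑ j ∈ Finset.range k, m j) (k : ℕ) :
    (P.bk i).size k = ∑ j ∈ Finset.range k, m.mapDomain (Equiv.swap i (i + 1)) j := by
  rw [sum_range_mapDomain_swap]
  split_ifs with hk
  · subst hk
    have h1 := P.size_bk_self i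
    rw [h, h, h, Finset.sum_range_succ _ (i + 1)] at h1
    omega
  · rw [size_bk_of_ne hk, h]

end GTPattern

open GTPattern in
/-- The number of semistandard tableaux of given shape and weight does not change when two adjacent
entries of the weight are exchanged. -/
theorem card_weight_mapDomain_swap (i : ℕ) (m : ℕ →₀ ℕ) :
    Nat.card {U : SemistandardYoungTableau μ // weight U = m.mapDomain (Equiv.swap i (i + 1))} =
      Nat.card {U : SemistandardYoungTableau μ // weight U = m} := by
  have key : ∀ m : ℕ →₀ ℕ, Nat.card {U : SemistandardYoungTableau μ // weight U = m} =
      Nat.card {P : GTPattern μ // ∀ k, P.size k = ∑ j ∈ Finset.range k, m j} := fun m =>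
    (Nat.card_congr (equivTableau.subtypeEquiv fun P => (P.weight_toTableau_iff m).symm)).symm
  rw [key, key]
  have hinv : (m.mapDomain (Equiv.swap i (i + 1))).mapDomain (Equiv.swap i (i + 1)) = m := by
    rw [← Finsupp.mapDomain_comp, ← Equiv.coe_trans, Equiv.swap_swap]
    exact Finsupp.mapDomain_id
  exact Nat.card_congr
    { toFun := fun P => ⟨P.1.bk i, fun k => by rw [size_bk_iff i _ P.1 P.2, hinv]⟩
      invFun := fun P => ⟨P.1.bk i, size_bk_iff i _ P.1 P.2⟩
      left_inv := fun P => Subtype.ext (bk_bk i P.1)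
      right_inv := fun P => Subtype.ext (bk_bk i P.1) }

/-! ### Standardization -/

theorem SYT.injOn (T : SYT μ) {a b : ℕ × ℕ} (ha : a ∈ μ.cells) (hb : b ∈ μ.cells)
    (h : T.1 a.1 a.2 = T.1 b.1 b.2) : a = b :=
  T.2.injOn ha hb h

theorem SYT.exists_cell (T : SYT μ) {s : ℕ} (hs : s < μ.card) :
    ∃ c ∈ μ.cells, T.1 c.1 c.2 = s :=
  T.2.surjOn hs

theorem SYT.card_lt (T : SYT μ) {s : ℕ} (hs : s ≤ μ.card) :
    (μ.cells.filter fun c => T.1 c.1 c.2 < s).card = s := by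
  conv_rhs => rw [← Finset.card_range s]
  refine Finset.card_nbij (fun c => T.1 c.1 c.2) ?_ ?_ ?_
  · intro c hc
    simpa using (Finset.mem_filter.1 hc).2
  · intro c hc d hd h
    exact T.injOn (Finset.mem_filter.1 hc).1 (Finset.mem_filter.1 hd).1 h
  · intro t ht
    have ht : t < s := by simpa using ht
    obtain ⟨c, hc, rfl⟩ := T.exists_cell (ht.trans_le hs)
    exact ⟨c, by simpa using ⟨hc, ht⟩, rfl⟩

theorem SemistandardYoungTableau.le_of_le (U : SemistandardYoungTableau μ) {a b : ℕ × ℕ}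
    (hb : b ∈ μ.cells) (h1 : a.1 ≤ b.1) (h2 : a.2 ≤ b.2) : U a.1 a.2 ≤ U b.1 b.2 :=
  (U.col_weak h1 (μ.up_left_mem le_rfl h2 hb)).trans (U.row_weak_of_le h2 hb)

/-- If an entry of a standard tableau lies in a higher row than a larger entry, then there is a
descent between them. -/
theorem exists_descent (T : SYT μ) {a b : ℕ × ℕ} (ha : a ∈ μ.cells) (hb : b ∈ μ.cells)
    (hT : T.1 a.1 a.2 < T.1 b.1 b.2) (h : a.1 < b.1) :
    ∃ d ∈ descents T, T.1 a.1 a.2 ≤ d ∧ (d : ℕ) < T.1 b.1 b.2 := by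
  obtain ⟨n, hn⟩ := Nat.exists_eq_add_of_lt hT
  induction n generalizing b with
  | zero =>
    have hb' : T.1 b.1 b.2 < μ.card := T.2.mapsTo hb
    refine ⟨⟨T.1 a.1 a.2, by omega⟩, ?_, le_rfl, hT⟩
    simp only [descents, Finset.mem_filter, Finset.mem_univ, true_and]
    exact ⟨a, ha, b, hb, rfl, by simpa using hn, h⟩
  | succ n ih =>
    have hb' : T.1 b.1 b.2 < μ.card := T.2.mapsTo hb
    obtain ⟨c, hc, hc'⟩ := T.exists_cell (s := T.1 a.1 a.2 + n + 1) (by omega)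
    rcases lt_or_ge c.1 b.1 with h1 | h1
    · refine ⟨⟨T.1 c.1 c.2, by omega⟩, ?_, ?_, ?_⟩
      · simp only [descents, Finset.mem_filter, Finset.mem_univ, true_and]
        exact ⟨c, hc, b, hb, rfl, by omega, h1⟩
      · change _ ≤ T.1 c.1 c.2
        omega
      · change T.1 c.1 c.2 < _
        omega
    · obtain ⟨d, hd, h2, h3⟩ := ih hc (by omega) (h.trans_le h1) hc'
      exact ⟨d, hd, h2, by omega⟩

/-- The order in which standardization numbers the cells: by entry, and from left to right among
equal entries. -/
def Before (U : SemistandardYoungTableau μ) (a b : ℕ × ℕ) : Prop :=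
  U a.1 a.2 < U b.1 b.2 ∨ U a.1 a.2 = U b.1 b.2 ∧ a.2 < b.2

theorem Before.trans {U : SemistandardYoungTableau μ} {a b c : ℕ × ℕ} (h1 : Before U a b)
    (h2 : Before U b c) : Before U a c := by
  unfold Before at *
  omega

theorem not_before_self (U : SemistandardYoungTableau μ) (a : ℕ × ℕ) : ¬ Before U a a := by
  unfold Before
  omega

theorem before_or_before (U : SemistandardYoungTableau μ) {a b : ℕ × ℕ} (ha : a ∈ μ.cells)
    (hb : b ∈ μ.cells) (hab : a ≠ b) : Before U a b ∨ Before U b a := by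
  unfold Before
  by_contra! h
  obtain ⟨i, j⟩ := a
  obtain ⟨i', j'⟩ := b
  have h1 : U i j = U i' j' := le_antisymm h.2.1 h.1.1
  obtain rfl : j = j' := le_antisymm (h.2.2 h1.symm) (h.1.2 h1)
  rcases lt_trichotomy i i' with h2 | rfl | h2
  · exact (U.col_strict h2 hb).ne h1
  · exact hab rfl
  · exact (U.col_strict h2 ha).ne' h1

open Classical in
/-- The number that standardization gives to the cell `a`. -/
noncomputable def stdEntry (U : SemistandardYoungTableau μ) (a : ℕ × ℕ) : ℕ :=
  (μ.cells.filter fun b => Before U b a).card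

theorem stdEntry_lt {U : SemistandardYoungTableau μ} {a b : ℕ × ℕ} (ha : a ∈ μ.cells)
    (h : Before U a b) : stdEntry U a < stdEntry U b := by
  classical
  refine Finset.card_lt_card ((Finset.ssubset_iff_of_subset ?_).2 ⟨a, ?_, ?_⟩)
  · intro c hc
    rw [Finset.mem_filter] at hc ⊢
    exact ⟨hc.1, hc.2.trans h⟩
  · simpa using ⟨ha, h⟩
  · simp [not_before_self]

theorem stdEntry_lt_card (U : SemistandardYoungTableau μ) {a : ℕ × ℕ} (ha : a ∈ μ.cells) :
    stdEntry U a < μ.card := by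
  classical
  refine Finset.card_lt_card ((Finset.ssubset_iff_of_subset (Finset.filter_subset _ _)).2
    ⟨a, ha, ?_⟩)
  simp [not_before_self]

theorem stdEntry_injOn (U : SemistandardYoungTableau μ) {a b : ℕ × ℕ} (ha : a ∈ μ.cells)
    (hb : b ∈ μ.cells) (h : stdEntry U a = stdEntry U b) : a = b := by
  by_contra hab
  rcases before_or_before U ha hb hab with h1 | h1
  · exact (stdEntry_lt ha h1).ne h
  · exact (stdEntry_lt hb h1).ne' h

theorem before_of_stdEntry_lt {U : SemistandardYoungTableau μ} {a b : ℕ × ℕ} (ha : a ∈ μ.cells)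
    (hb : b ∈ μ.cells) (h : stdEntry U a < stdEntry U b) : Before U a b := by
  refine (before_or_before U ha hb ?_).resolve_right fun h1 => (stdEntry_lt hb h1).asymm h
  rintro rfl
  exact h.false

/-- A tableau is recovered from its standardization and its weight. -/
theorem stdEntry_lt_iff (U : SemistandardYoungTableau μ) {a : ℕ × ℕ} (ha : a ∈ μ.cells) (k : ℕ) :
    stdEntry U a < (μ.cells.filter fun c => U c.1 c.2 < k).card ↔ U a.1 a.2 < k := by
  classical
  constructor
  · intro h
    by_contra! h1
    refine h.not_ge (Finset.card_le_card fun c hc => ?_)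
    rw [Finset.mem_filter] at hc ⊢
    exact ⟨hc.1, .inl (hc.2.trans_le h1)⟩
  · intro h
    refine Finset.card_lt_card ((Finset.ssubset_iff_of_subset fun c hc => ?_).2 ⟨a, ?_, ?_⟩)
    · rw [Finset.mem_filter] at hc ⊢
      refine ⟨hc.1, lt_of_le_of_lt ?_ h⟩
      rcases hc.2 with h1 | h1
      · exact h1.le
      · exact h1.1.le
    · simpa using ⟨ha, h⟩
    · simp [not_before_self]

open Classical in
/-- The standardization of a semistandard tableau. -/
noncomputable def std (U : SemistandardYoungTableau μ) : SYT μ where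
  val :=
    { entry := fun i j => if (i, j) ∈ μ then stdEntry U (i, j) else 0
      row_weak' := by
        intro i j1 j2 hj h
        have h1 := μ.up_left_mem le_rfl hj.le h
        rw [if_pos h1, if_pos h]
        refine (stdEntry_lt h1 ?_).le
        rcases (U.row_weak hj h).lt_or_eq with h2 | h2
        · exact .inl h2
        · exact .inr ⟨h2, hj⟩
      col_strict' := by
        intro i1 i2 j hi h
        have h1 := μ.up_left_mem hi.le le_rfl h
        rw [if_pos h1, if_pos h]
        exact stdEntry_lt h1 (.inl (U.col_strict hi h))
      zeros' := fun h => if_neg h }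
  property := by
    have key : ∀ c ∈ μ.cells, (if (c.1, c.2) ∈ μ then stdEntry U (c.1, c.2) else 0) =
        stdEntry U c := fun c hc => if_pos hc
    refine Set.BijOn.congr (f₁ := stdEntry U) ?_ fun c hc => (key c hc).symm
    have hinj : Set.InjOn (stdEntry U) μ.cells := fun a ha b hb h => stdEntry_injOn U ha hb h
    refine ⟨fun a ha => stdEntry_lt_card U ha, hinj, ?_⟩
    have himg : μ.cells.image (stdEntry U) = Finset.range μ.card := by
      refine Finset.eq_of_subset_of_card_le ?_ ?_
      · intro s hs
        obtain ⟨a, ha, rfl⟩ := Finset.mem_image.1 hs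
        exact Finset.mem_range.2 (stdEntry_lt_card U ha)
      · rw [Finset.card_image_of_injOn hinj, Finset.card_range]
    intro s hs
    have : s ∈ μ.cells.image (stdEntry U) := himg ▸ Finset.mem_range.2 hs
    simpa using this

theorem std_apply (U : SemistandardYoungTableau μ) {a : ℕ × ℕ} (ha : a ∈ μ.cells) :
    (std U).1 a.1 a.2 = stdEntry U a :=
  if_pos ha

theorem std_injective {U U' : SemistandardYoungTableau μ} (hw : weight U = weight U')
    (h : std U = std U') : U = U' := by
  ext i j
  by_cases hc : (i, j) ∈ μ
  · refine eq_of_forall_gt_iff fun k => ?_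
    have hc' : (i, j) ∈ μ.cells := hc
    have h1 := stdEntry_lt_iff U hc' k
    have h2 := stdEntry_lt_iff U' hc' k
    rw [← std_apply U hc', (weight_eq_iff U _).1 rfl, h, hw] at h1
    rw [← std_apply U' hc', (weight_eq_iff U' _).1 rfl] at h2
    exact h1.symm.trans h2
  · rw [U.zeros hc, U'.zeros hc]

/-- A descent of the standardization of `U` is the last number given to the entries smaller than
some `k`. -/
theorem exists_of_mem_descents_std (U : SemistandardYoungTableau μ) {d : Fin (μ.card - 1)}
    (hd : d ∈ descents (std U)) : ∃ k, ∑ i ∈ Finset.range k, weight U i = (d : ℕ) + 1 := by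
  simp only [descents, Finset.mem_filter, Finset.mem_univ, true_and] at hd
  obtain ⟨a, ha, b, hb, h1, h2, h3⟩ := hd
  rw [std_apply U ha] at h1
  rw [std_apply U hb] at h2
  have hlt : U a.1 a.2 < U b.1 b.2 := by
    rcases before_of_stdEntry_lt (U := U) ha hb (by omega) with h | h
    · exact h
    · have h4 := U.col_strict h3 (μ.up_left_mem le_rfl h.2.le hb)
      have h5 := U.row_weak h.2 hb
      omega
  refine ⟨U b.1 b.2, ?_⟩
  rw [sum_range_weight]
  have h4 := (stdEntry_lt_iff U ha (U b.1 b.2)).2 hlt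
  have h5 := mt (stdEntry_lt_iff U hb (U b.1 b.2)).1 (lt_irrefl _)
  omega

/-- Every standard tableau each of whose descents is cut off by a partial sum of `m` is the
standardization of a tableau of weight `m`: replace the numbers from one partial sum to the next
by equal entries. -/
theorem exists_std_eq (T : SYT μ) (m : ℕ →₀ ℕ) {N : ℕ}
    (hle : ∀ k, ∑ i ∈ Finset.range k, m i ≤ μ.card)
    (hN : ∑ i ∈ Finset.range N, m i = μ.card)
    (hT : ∀ d ∈ descents T, ∃ k, ∑ i ∈ Finset.range k, m i = (d : ℕ) + 1) :
    ∃ U : SemistandardYoungTableau μ, weight U = m ∧ std U = T := by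
  classical
  have hmono : Monotone fun k => ∑ i ∈ Finset.range k, m i := fun k l h =>
    Finset.sum_le_sum_of_subset (Finset.range_mono h)
  have hex : ∀ {a : ℕ × ℕ}, a ∈ μ.cells → ∃ k, T.1 a.1 a.2 < ∑ i ∈ Finset.range (k + 1), m i :=
    fun ha => ⟨N, (T.2.mapsTo ha).trans_le (hN.symm.le.trans (hmono (Nat.le_succ N)))⟩
  let u : ℕ × ℕ → ℕ := fun a => if h : a ∈ μ.cells then Nat.find (hex h) else 0
  have hu : ∀ a ∈ μ.cells, ∀ k, u a < k ↔ T.1 a.1 a.2 < ∑ i ∈ Finset.range k, m i := by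
    intro a ha k
    simp only [u, dif_pos ha, Nat.find_lt_iff]
    constructor
    · rintro ⟨l, hl, h⟩
      exact h.trans_le (hmono hl)
    · intro h
      rcases k with _ | k
      · simp at h
      · exact ⟨k, Nat.lt_succ_self k, h⟩
  have hule : ∀ a ∈ μ.cells, ∀ b ∈ μ.cells, T.1 a.1 a.2 ≤ T.1 b.1 b.2 → u a ≤ u b := by
    intro a ha b hb h
    exact Nat.lt_succ_iff.1 ((hu a ha _).2 (h.trans_lt ((hu b hb _).1 (Nat.lt_succ_self _))))
  have hult : ∀ a ∈ μ.cells, ∀ b ∈ μ.cells, T.1 a.1 a.2 < T.1 b.1 b.2 → a.1 < b.1 →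
      u a < u b := by
    intro a ha b hb h h1
    obtain ⟨d, hd, h2, h3⟩ := exists_descent T ha hb h h1
    obtain ⟨k, hk⟩ := hT d hd
    have h4 := (hu a ha k).2 (by omega)
    have h5 := mt (hu b hb k).1 (by omega)
    omega
  let U : SemistandardYoungTableau μ :=
    { entry := fun i j => u (i, j)
      row_weak' := fun {i j1 j2} hj h => hule _ (μ.up_left_mem le_rfl hj.le h) _ h
        (T.1.row_weak hj h)
      col_strict' := fun {i1 i2 j} hi h => hult _ (μ.up_left_mem hi.le le_rfl h) _ h
        (T.1.col_strict hi h) hi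
      zeros' := fun {i j} h => dif_neg h }
  have hU : ∀ a : ℕ × ℕ, U a.1 a.2 = u a := fun _ => rfl
  refine ⟨U, ?_, ?_⟩
  · rw [weight_eq_iff]
    intro k
    rw [← T.card_lt (hle k)]
    congr 1
    exact Finset.filter_congr fun c hc => hu c hc k
  · have hB : ∀ a ∈ μ.cells, ∀ b ∈ μ.cells, Before U a b → T.1 a.1 a.2 < T.1 b.1 b.2 := by
      intro a ha b hb h
      by_contra! h1
      have h2 := hule b hb a ha h1
      rcases h with h | ⟨h, h3⟩
      · exact absurd h (not_lt.2 h2)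
      · have hab : a ≠ b := fun hab => h3.ne (congrArg Prod.snd hab)
        have h1 : T.1 b.1 b.2 < T.1 a.1 a.2 := h1.lt_of_ne fun h4 => hab (T.injOn ha hb h4.symm)
        rcases lt_or_ge b.1 a.1 with h4 | h4
        · exact absurd h (hult b hb a ha h1 h4).ne'
        · exact h1.not_ge (SemistandardYoungTableau.le_of_le T.1 hb h4 h3.le)
    refine Subtype.ext (SemistandardYoungTableau.ext fun i j => ?_)
    by_cases hc : (i, j) ∈ μ
    · have hc' : (i, j) ∈ μ.cells := hc
      rw [std_apply U hc', ← T.card_lt (show T.1 i j ≤ μ.card from (T.2.mapsTo hc').le), stdEntry]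
      congr 1
      refine Finset.filter_congr fun b hb => ⟨hB b hb _ hc', fun h => ?_⟩
      refine (before_or_before U hb hc' ?_).resolve_right fun h1 => (hB _ hc' b hb h1).asymm h
      rintro rfl
      exact h.false
    · rw [(std U).1.zeros hc, T.1.zeros hc]

theorem listRefines_desComp_iff (T : SYT μ) (m : ℕ →₀ ℕ) :
    ListRefines (exponents m) (desComp T).parts ↔ (exponents m).sum = μ.card ∧
      ∀ d ∈ descents T, ∃ k, ∑ i ∈ Finset.range k, m i = (d : ℕ) + 1 := by
  rw [listRefines_iff fun x hx => exponents_pos hx]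
  have : (desComp T).parts.sum = μ.card := (desComp T).2.blocks_sum
  rw [this]
  refine and_congr_right fun h => ?_
  simp only [isPrefixSum_desComp, ← isPrefixSum_exponents]
  constructor
  · exact fun h1 d hd => h1 _ (.inr (.inr ⟨d, hd, rfl⟩))
  · rintro h1 s (rfl | rfl | ⟨d, hd, rfl⟩)
    · exact .zero _
    · exact h ▸ .sum _
    · exact h1 d hd

/-- Standardization is a bijection from the semistandard tableaux of weight `m` to the standard
tableaux whose descent composition is refined by the composition of nonzero entries of `m`. -/
theorem card_weight_eq (μ : YoungDiagram) (m : ℕ →₀ ℕ) :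
    Nat.card {U : SemistandardYoungTableau μ // weight U = m} =
      Nat.card {T : SYT μ // ListRefines (exponents m) (desComp T).parts} := by
  obtain ⟨N, hN⟩ := exists_bound m
  have hsum : ∀ k, N ≤ k → ∑ i ∈ Finset.range k, m i = (exponents m).sum := fun k hk =>
    (sum_exponents fun i hi => (hN i hi).trans_le hk).symm
  refine Nat.card_congr (Equiv.ofBijective (fun U => ⟨std U.1, ?_⟩) ⟨?_, ?_⟩)
  · obtain ⟨U, rfl⟩ := U
    refine (listRefines_desComp_iff _ _).2 ⟨?_, fun d hd => exists_of_mem_descents_std U hd⟩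
    rw [← hsum (max N ((μ.cells.sup fun c => U c.1 c.2) + 1)) (le_max_left _ _), sum_range_weight,
      Finset.filter_true_of_mem fun c hc => ?_]
    have : U c.1 c.2 ≤ _ := Finset.le_sup (f := fun c : ℕ × ℕ => U c.1 c.2) hc
    omega
  · intro U U' h
    exact Subtype.ext (std_injective (U.2.trans U'.2.symm) (congrArg Subtype.val h))
  · rintro ⟨T, hT⟩
    obtain ⟨h1, h2⟩ := (listRefines_desComp_iff T m).1 hT
    obtain ⟨U, hU, rfl⟩ := exists_std_eq T m (fun k => by
      rw [← h1, ← hsum (max N k) (le_max_left _ _)]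
      exact Finset.sum_le_sum_of_subset (Finset.range_mono (le_max_right _ _)))
      ((hsum N le_rfl).trans h1) h2
    exact ⟨⟨U, hU⟩, rfl⟩

theorem sumF_eq_linearCombination {R : Type*} [CommRing R] (c : Comp →₀ R) :
    sumF c = Finsupp.linearCombination R (fundamental R) c :=
  (Finsupp.linearCombination_apply R c).symm

theorem sumSchur_eq_linearCombination {R : Type*} [CommRing R] (a : YoungDiagram →₀ R) :
    sumSchur a = Finsupp.linearCombination R (schur R) a :=
  (Finsupp.linearCombination_apply R a).symm

/-- Gessel's expansion of a Schur function in fundamental quasisymmetric functions. -/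
theorem schur_eq_sumF (R : Type*) [CommRing R] (μ : YoungDiagram) :
    schur R μ = sumF (desCoeffs R μ) := by
  classical
  ext m
  rw [sumF_eq_linearCombination, desCoeffs, map_sum, map_sum]
  simp only [Finsupp.linearCombination_single, one_smul, coeff_fundamental]
  rw [Finset.sum_boole, ← Fintype.card_subtype, ← Nat.card_eq_fintype_card, ← card_weight_eq]
  rfl

theorem isSymmetric_schur (R : Type*) [CommRing R] (μ : YoungDiagram) :
    IsSymmetric (schur R μ) := by
  have key : ∀ i m, MvPowerSeries.coeff (m.mapDomain (Equiv.swap i (i + 1))) (schur R μ) =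
      MvPowerSeries.coeff m (schur R μ) := fun i m =>
    congrArg (Nat.cast (R := R)) (card_weight_mapDomain_swap i m)
  rw [schur_eq_sumF] at key ⊢
  exact isSymmetric_sumF _ key

/-! ### Leading compositions -/

theorem Comp.parts_injective : Function.Injective Comp.parts := by
  rintro ⟨n, b, hb, rfl⟩ ⟨n', b', hb', rfl⟩ h
  obtain rfl : b = b' := h
  rfl

theorem Comp.parts_pos (α : Comp) {x : ℕ} (hx : x ∈ α.parts) : 0 < x :=
  α.2.blocks_pos hx

theorem Comp.rowLens_diagram (α : Comp) (hα : α.IsPartition) :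
    (α.diagram hα).rowLens = α.parts :=
  YoungDiagram.rowLens_ofRowLens_eq_self fun _ hx => α.parts_pos hx

theorem Comp.card_diagram (α : Comp) (hα : α.IsPartition) : (α.diagram hα).card = α.1 := by
  have h := card_cells_row_lt (μ := α.diagram hα) (α.diagram hα).rowLens.length
  rw [List.take_length, Finset.filter_true_of_mem fun c hc => ?_, α.rowLens_diagram hα] at h
  · exact h.trans α.2.blocks_sum
  · rw [YoungDiagram.length_rowLens, ← YoungDiagram.mem_iff_lt_colLen]
    exact (α.diagram hα).up_left_mem le_rfl (Nat.zero_le _) hc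

variable {R : Type*} [CommRing R]

theorem IsLeading.unique {c : Comp →₀ R} {α β : Comp} (hα : IsLeading c α) (hβ : IsLeading c β) :
    α = β :=
  Comp.parts_injective (le_antisymm (hβ.2 α hα.1) (hα.2 β hβ.1))

theorem exists_isLeading {c : Comp →₀ R} (hc : c ≠ 0) : ∃ α, IsLeading c α := by
  obtain ⟨α, hα, hmax⟩ :=
    c.support.exists_max_image Comp.parts (Finsupp.support_nonempty_iff.2 hc)
  exact ⟨α, Finsupp.mem_support_iff.1 hα, fun β hβ => hmax β (Finsupp.mem_support_iff.2 hβ)⟩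

/-- A composition is lexicographically smaller than those which it refines properly. So the leading
coefficient of an `F`-expansion is the coefficient of a monomial. -/
theorem IsLeading.coeff_parts {c : Comp →₀ R} {α : Comp} (h : IsLeading c α) :
    MvPowerSeries.coeff (ofList α.parts) (sumF c) = c α := by
  classical
  rw [coeff_sumF, exponents_ofList fun x hx => α.parts_pos hx,
    Finset.sum_eq_single_of_mem α (Finsupp.mem_support_iff.2 h.1), if_pos (.refl _)]
  intro β hβ hne
  refine if_neg fun h1 => hne (Comp.parts_injective (le_antisymm ?_ ?_))
  · exact h.2 β (Finsupp.mem_support_iff.1 hβ)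
  · exact h1.le (fun x hx => α.parts_pos hx) fun x hx => β.parts_pos hx

theorem IsLeading.le_parts {c : Comp →₀ R} {α : Comp} (h : IsLeading c α) {l : List ℕ}
    (hl : ∀ x ∈ l, 0 < x) (h0 : MvPowerSeries.coeff (ofList l) (sumF c) ≠ 0) : l ≤ α.parts := by
  classical
  rw [coeff_sumF, exponents_ofList hl] at h0
  obtain ⟨β, hβ, h1⟩ := Finset.exists_ne_zero_of_sum_ne_zero h0
  rw [ne_eq, ite_eq_right_iff, not_forall] at h1
  obtain ⟨h1, -⟩ := h1
  exact (h1.le hl fun x hx => β.parts_pos hx).trans (h.2 β (Finsupp.mem_support_iff.1 hβ))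

/-- If the leading composition were not weakly decreasing, then some rearrangement of its parts would
be larger, although it has the same coefficient by symmetry. -/
theorem IsLeading.isPartition {c : Comp →₀ R} {α : Comp} (h : IsLeading c α)
    (hc : IsSymmetric (sumF c)) : α.IsPartition := by
  by_contra hα
  obtain ⟨l, hperm, hlt⟩ := exists_perm_lt hα
  have h1 := eq_of_perm (g := fun m => MvPowerSeries.coeff m (sumF c)) (fun i m => hc _ m) hperm
  have h2 := h.le_parts (l := l) (fun x hx => α.parts_pos (hperm.mem_iff.2 hx)) (by
    rw [← h1]
    exact h.coeff_parts.trans_ne h.1)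
  exact h2.not_gt hlt

theorem coeff_schur_rowLens (μ : YoungDiagram) :
    MvPowerSeries.coeff (ofList μ.rowLens) (schur R μ) = 1 :=
  (congrArg (Nat.cast (R := R)) (card_weight_rowLens μ)).trans Nat.cast_one

theorem le_rowLens_of_coeff_schur_ne_zero {μ : YoungDiagram} {l : List ℕ} (hl : ∀ x ∈ l, 0 < x)
    (h : MvPowerSeries.coeff (ofList l) (schur R μ) ≠ 0) : l ≤ μ.rowLens := by
  have h1 : Nat.card {U : SemistandardYoungTableau μ // weight U = ofList l} ≠ 0 := by
    intro h0
    exact h ((congrArg (Nat.cast (R := R)) h0).trans Nat.cast_zero)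
  obtain ⟨U, hU⟩ := (Nat.card_ne_zero.1 h1).1
  exact le_rowLens_of_weight hl U hU

theorem coeff_sumSchur (a : YoungDiagram →₀ R) (m : ℕ →₀ ℕ) :
    MvPowerSeries.coeff m (sumSchur a) =
      ∑ μ ∈ a.support, a μ * MvPowerSeries.coeff m (schur R μ) := by
  rw [sumSchur, Finsupp.sum, map_sum]
  exact Finset.sum_congr rfl fun μ _ => MvPowerSeries.coeff_smul _ _ _

/-- The leading terms of the `F`-expansion and of the Schur expansion of a function agree. -/
theorem IsLeading.eq_coeff_schur {c : Comp →₀ R} {α : Comp} (h : IsLeading c α)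
    (hα : α.IsPartition) {a : YoungDiagram →₀ R} (ha : sumF c = sumSchur a) :
    a (α.diagram hα) = c α := by
  have hex : ∃ μ ∈ a.support, α.parts ≤ μ.rowLens := by
    have h0 := h.coeff_parts.trans_ne h.1
    rw [ha, coeff_sumSchur] at h0
    obtain ⟨μ, hμ, h1⟩ := Finset.exists_ne_zero_of_sum_ne_zero h0
    exact ⟨μ, hμ, le_rowLens_of_coeff_schur_ne_zero (fun x hx => α.parts_pos hx)
      (right_ne_zero_of_mul h1)⟩
  obtain ⟨ν, hν, hle⟩ := hex
  obtain ⟨μ, hμ, hmax⟩ := a.support.exists_max_image YoungDiagram.rowLens ⟨ν, hν⟩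
  have hinj : ∀ ν : YoungDiagram, ν.rowLens = μ.rowLens → ν = μ := fun ν h =>
    YoungDiagram.equivListRowLens.injective (Subtype.ext h)
  have hcoeff : MvPowerSeries.coeff (ofList μ.rowLens) (sumF c) = a μ := by
    rw [ha, coeff_sumSchur, Finset.sum_eq_single_of_mem μ hμ, coeff_schur_rowLens, mul_one]
    intro ν hν hne
    by_contra h0
    exact hne (hinj ν (le_antisymm (hmax ν hν)
      (le_rowLens_of_coeff_schur_ne_zero μ.pos_of_mem_rowLens (right_ne_zero_of_mul h0))))
  have heq : μ.rowLens = α.parts := le_antisymm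
    (h.le_parts μ.pos_of_mem_rowLens (hcoeff.trans_ne (Finsupp.mem_support_iff.1 hμ)))
    (hle.trans (hmax ν hν))
  rw [hinj (α.diagram hα) ((α.rowLens_diagram hα).trans heq.symm), ← hcoeff, heq, h.coeff_parts]

/-! ### Positivity -/

theorem desCoeffs_nonneg [PartialOrder R] [IsOrderedRing R] (μ : YoungDiagram) (β : Comp) :
    0 ≤ desCoeffs R μ β := by
  classical
  rw [desCoeffs, Finsupp.finsetSum_apply]
  refine Finset.sum_nonneg fun T _ => ?_
  rw [Finsupp.single_apply]
  split_ifs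
  · exact zero_le_one
  · exact le_rfl

theorem SchurPositive.fPositive [PartialOrder R] [IsOrderedRing R] {f : MvPowerSeries ℕ R}
    (hf : SchurPositive f) : FPositive f := by
  obtain ⟨a, ha, rfl⟩ := hf
  refine ⟨∑ μ ∈ a.support, a μ • desCoeffs R μ, fun β => ?_, ?_⟩
  · rw [Finsupp.finsetSum_apply]
    exact Finset.sum_nonneg fun μ _ => mul_nonneg (ha μ) (desCoeffs_nonneg μ β)
  · rw [sumF_eq_linearCombination, map_sum, sumSchur, Finsupp.sum]
    refine Finset.sum_congr rfl fun μ _ => ?_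
    rw [map_smul, ← sumF_eq_linearCombination, schur_eq_sumF]

theorem sumSchur_sub (a : YoungDiagram →₀ R) (μ : YoungDiagram) :
    sumSchur a - a μ • schur R μ = sumSchur (a.erase μ) := by
  rw [sub_eq_iff_eq_add', sumSchur_eq_linearCombination, sumSchur_eq_linearCombination,
    ← Finsupp.linearCombination_single R (a μ) μ, ← map_add, Finsupp.single_add_erase]

/-! ### The peeling algorithm -/

theorem peel_eq {p : (Comp →₀ R) × (YoungDiagram →₀ R)} {α : Comp} (h : IsLeading p.1 α)
    (hα : α.IsPartition) :
    peel p = (p.1 - p.1 α • desCoeffs R (α.diagram hα),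
      p.2 + Finsupp.single (α.diagram hα) (p.1 α)) := by
  have hex : ∃ α : Comp, IsLeading p.1 α ∧ α.IsPartition := ⟨α, h, hα⟩
  have hch : hex.choose = α := hex.choose_spec.1.unique h
  rw [peel, dif_pos hex]
  simp only [hch]

theorem sumF_sub_smul_desCoeffs (c : Comp →₀ R) (r : R) (μ : YoungDiagram) :
    sumF (c - r • desCoeffs R μ) = sumF c - r • schur R μ := by
  rw [schur_eq_sumF]
  simp only [sumF_eq_linearCombination, map_sub, map_smul]

theorem IsSymmetric.sub_smul {f g : MvPowerSeries ℕ R} (hf : IsSymmetric f) (hg : IsSymmetric g)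
    (r : R) : IsSymmetric (f - r • g) := by
  intro σ m
  rw [map_sub, map_sub, MvPowerSeries.coeff_smul, MvPowerSeries.coeff_smul, hf, hg]

theorem fst_eq_card_of_desCoeffs_ne_zero {μ : YoungDiagram} {β : Comp}
    (h : desCoeffs R μ β ≠ 0) : β.1 = μ.card := by
  classical
  rw [desCoeffs, Finsupp.finsetSum_apply] at h
  obtain ⟨T, -, h1⟩ := Finset.exists_ne_zero_of_sum_ne_zero h
  rw [Finsupp.single_apply, ne_eq, ite_eq_right_iff, not_forall] at h1
  obtain ⟨rfl, -⟩ := h1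
  rfl

/-- One round of the algorithm makes the leading composition lexicographically smaller. -/
theorem IsLeading.parts_lt {c : Comp →₀ R} {α β : Comp} (h : IsLeading c α) (hα : α.IsPartition)
    (hβ : (c - c α • desCoeffs R (α.diagram hα)) β ≠ 0) : β.parts < α.parts := by
  obtain ⟨γ, hγ⟩ := exists_isLeading (c := c - c α • desCoeffs R (α.diagram hα)) (by
    rintro h0
    simp [h0] at hβ)
  refine (hγ.2 β hβ).trans_lt ?_
  have h0 := hγ.coeff_parts.trans_ne hγ.1
  rw [sumF_sub_smul_desCoeffs, map_sub, MvPowerSeries.coeff_smul] at h0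
  by_contra! hle
  rcases hle.lt_or_eq with hlt | heq
  · refine h0 ?_
    have h1 : MvPowerSeries.coeff (ofList γ.parts) (sumF c) = 0 := by
      by_contra h1
      exact (h.le_parts (fun x hx => γ.parts_pos hx) h1).not_gt hlt
    have h2 : MvPowerSeries.coeff (ofList γ.parts) (schur R (α.diagram hα)) = 0 := by
      by_contra h2
      have h3 := le_rowLens_of_coeff_schur_ne_zero (fun x hx => γ.parts_pos hx) h2
      rw [α.rowLens_diagram hα] at h3
      exact h3.not_gt hlt
    rw [h1, h2, mul_zero, sub_zero]
  · have h1 : MvPowerSeries.coeff (ofList α.parts) (schur R (α.diagram hα)) = 1 := by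
      rw [← α.rowLens_diagram hα, coeff_schur_rowLens]
    rw [← heq, h.coeff_parts, h1, mul_one, sub_self] at h0
    exact h0 rfl

/-- The algorithm terminates, because the leading compositions decrease inside the finite set of
compositions of the sizes in `K`. -/
theorem exists_iterate_peel (K : Finset ℕ) (c : Comp →₀ R) (g : YoungDiagram →₀ R)
    (hK : ∀ β, c β ≠ 0 → β.1 ∈ K) (hc : IsSymmetric (sumF c)) :
    ∃ N : ℕ,
      (∀ k < N, ∃ α : Comp, IsLeading (peel^[k] (c, g)).1 α ∧ α.IsPartition) ∧
      (peel^[N] (c, g)).1 = 0 ∧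
      sumF c + sumSchur g = sumSchur (peel^[N] (c, g)).2 := by
  classical
  induction hn : ((K.sigma fun _ => Finset.univ).filter fun γ : Comp =>
      ∃ δ, c δ ≠ 0 ∧ γ.parts ≤ δ.parts).card using Nat.strong_induction_on generalizing c g with
  | _ n ih =>
    rcases eq_or_ne c 0 with rfl | hne
    · refine ⟨0, by simp, rfl, ?_⟩
      rw [sumF_eq_linearCombination, map_zero, zero_add]
      rfl
    obtain ⟨α, h⟩ := exists_isLeading hne
    have hα := h.isPartition hc
    have hpeel := peel_eq (p := (c, g)) h hα
    set μ := α.diagram hα with hμ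
    set c' := c - c α • desCoeffs R μ with hc'
    have hlt : ∀ β, c' β ≠ 0 → β.parts < α.parts := fun β hβ => h.parts_lt hα hβ
    have hK' : ∀ β, c' β ≠ 0 → β.1 ∈ K := by
      intro β hβ
      by_cases h0 : c β = 0
      · have h1 : desCoeffs R μ β ≠ 0 := by
          intro h1
          simp [hc', h0, h1] at hβ
        rw [fst_eq_card_of_desCoeffs_ne_zero h1, hμ, α.card_diagram hα]
        exact hK α h.1
      · exact hK β h0
    have hsym : IsSymmetric (sumF c') := by
      rw [hc', sumF_sub_smul_desCoeffs]
      exact hc.sub_smul (isSymmetric_schur R μ) _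
    obtain ⟨N, h1, h2, h3⟩ := ih _ (by
      rw [← hn]
      refine Finset.card_lt_card ((Finset.ssubset_iff_of_subset fun γ hγ => ?_).2 ⟨α, ?_, ?_⟩)
      · rw [Finset.mem_filter] at hγ ⊢
        obtain ⟨hγ, δ, hδ, hle⟩ := hγ
        exact ⟨hγ, α, h.1, hle.trans (hlt δ hδ).le⟩
      · exact Finset.mem_filter.2 ⟨by simpa using hK α h.1, α, h.1, le_rfl⟩
      · rw [Finset.mem_filter]
        rintro ⟨-, δ, hδ, hle⟩
        exact hle.not_gt (hlt δ hδ)) c' (g + Finsupp.single μ (c α)) hK' hsym rfl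
    refine ⟨N + 1, fun k hk => ?_, ?_, ?_⟩
    · rcases k with _ | k
      · exact ⟨α, h, hα⟩
      · rw [Function.iterate_succ_apply, hpeel]
        exact h1 k (by omega)
    · rw [Function.iterate_succ_apply, hpeel]
      exact h2
    · rw [Function.iterate_succ_apply, hpeel, ← h3, hc', sumF_sub_smul_desCoeffs,
        sumSchur_eq_linearCombination, sumSchur_eq_linearCombination, map_add,
        Finsupp.linearCombination_single]
      abel

end QSym

theorem mainTheorem8 {R : Type*} [CommRing R] [PartialOrder R] [IsOrderedRing R]
    (f : MvPowerSeries ℕ R) (hf : QSym.IsSymmetric f)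
    (c : QSym.Comp →₀ R) (hc : f = QSym.sumF c) :
    (∀ α : QSym.Comp, QSym.IsLeading c α →
      ∃ hα : α.IsPartition,
        QSym.SchurPositive f →
          QSym.SchurPositive (f - c α • QSym.schur R (α.diagram hα)) ∧
          QSym.FPositive (f - c α • QSym.schur R (α.diagram hα))) ∧
    (∃ N : ℕ,
      (∀ k < N, ∃ α : QSym.Comp,
        QSym.IsLeading (QSym.peel^[k] (c, 0)).1 α ∧ α.IsPartition) ∧
      (QSym.peel^[N] (c, 0)).1 = 0 ∧
      f = QSym.sumSchur (QSym.peel^[N] (c, 0)).2) := by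
  classical
  subst hc
  constructor
  · intro α h
    refine ⟨h.isPartition hf, fun ⟨a, ha, hfa⟩ => ?_⟩
    have key : QSym.SchurPositive (QSym.sumF c -
        c α • QSym.schur R (α.diagram (h.isPartition hf))) := by
      refine ⟨a.erase (α.diagram (h.isPartition hf)), fun μ => ?_, ?_⟩
      · rw [Finsupp.erase_apply]
        split_ifs
        · exact le_rfl
        · exact ha μ
      · rw [← QSym.sumSchur_sub, h.eq_coeff_schur _ hfa, hfa]
    exact ⟨key, key.fPositive⟩
  · obtain ⟨N, h1, h2, h3⟩ := QSym.exists_iterate_peel (c.support.image Sigma.fst) c 0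
      (fun β hβ => Finset.mem_image_of_mem _ (Finsupp.mem_support_iff.2 hβ)) hf
    refine ⟨N, h1, h2, Eq.trans ?_ h3⟩
    rw [QSym.sumSchur_eq_linearCombination, map_zero, add_zero]
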